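/- Let $q$ be a power of a prime number, let $\mathbb F_q$ be the field with $q$ elements, and let $a, b \in \mathbb F_q[z]$ be distinct non-constant polynomials. Let $\mathbf t = t_0 t_1 t_2 \ldots = abbabaab\ldots$ be the Thue--Morse word over $\{a,b\}$, defined by $t_0 = a$, $t_{2k} = t_k$, and $t_{2k+1} = a$ (resp. $b$) if $t_k = b$ (resp. $a$), for $k \ge 0$. Then there is a unique Laurent series $\xi_{q,a,b} \in \mathbb F_q((z^{-1}))$ whose continued fraction expansion is $$\xi_{q,a,b} = [0; t_0, t_1, t_2, \ldots]$$ (where the continued fraction algorithm takes as partial quotients the polynomial parts of the successive complete quotients), and $\xi_{q,a,b}$ is either transcendental over $\mathbb F_q(z)$ or algebraic over $\mathbb F_q(z)$ of degree at least $4$. -/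

import Mathlib

open Polynomial

noncomputable section

/-- The field `F((z⁻¹))` of formal Laurent series `∑_{h ≥ -m} a_h z^{-h}`. The underlying series ring
is that of Laurent series in one variable, which plays the role of `z⁻¹`: the coefficient
of index `h : ℤ` is the coefficient of `z^{-h}`. This is a separate type because Mathlib makes
`LaurentSeries F` an algebra over `F(z)` by expansion at `z = 0`, while here `F(z)` is expanded at
`z = ∞`. -/
def InvLaurentSeries (F : Type*) [Field F] : Type _ := LaurentSeries F

namespace InvLaurentSeries

variable {F : Type*} [Field F]

instance : Field (InvLaurentSeries F) := inferInstanceAs (Field (LaurentSeries F))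

/-- The underlying Laurent series in the variable `z⁻¹`. -/
def toLaurent (ξ : InvLaurentSeries F) : LaurentSeries F := ξ

/-- The coefficient of `z^{-h}` in `ξ`. -/
def coeff (ξ : InvLaurentSeries F) (h : ℤ) : F := HahnSeries.coeff ξ.toLaurent h

variable (F) in
/-- The embedding `F[z] → F((z⁻¹))`: constants are sent to constant series, and `z` to the series
whose only nonzero coefficient is that of `z^{-(-1)}`, equal to `1`. -/
def ofPoly : F[X] →+* InvLaurentSeries F :=
  Polynomial.eval₂RingHom (S := LaurentSeries F) HahnSeries.C (HahnSeries.single (-1) 1)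

theorem coeff_ofPoly (p : F[X]) (n : ℕ) : (ofPoly F p).coeff (-(n : ℤ)) = p.coeff n := by
  have key : ∀ p : F[X], HahnSeries.coeff (Polynomial.eval₂ (S := LaurentSeries F) HahnSeries.C
      (HahnSeries.single (-1) 1) p) (-(n : ℤ)) = p.coeff n := by
    intro p
    induction p using Polynomial.induction_on' with
    | add p q hp hq => simp [hp, hq]
    | monomial k r =>
      rw [Polynomial.eval₂_monomial, HahnSeries.single_pow, HahnSeries.C_apply,
        HahnSeries.single_mul_single, HahnSeries.coeff_single, Polynomial.coeff_monomial]
      by_cases h : k = n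
      · subst h; simp
      · rw [if_neg (by simp; omega), if_neg h]
  exact key p

theorem ofPoly_injective : Function.Injective (ofPoly F) := by
  intro p q h
  ext n
  rw [← coeff_ofPoly, ← coeff_ofPoly, h]

/-- The embedding `F(z) → F((z⁻¹))` extending `ofPoly`. -/
instance : Algebra (RatFunc F) (InvLaurentSeries F) :=
  (RatFunc.liftRingHom (ofPoly F)
    (nonZeroDivisors_le_comap_nonZeroDivisors_of_injective _ ofPoly_injective)).toAlgebra

theorem algebraMap_algebraMap (p : F[X]) :
    algebraMap (RatFunc F) (InvLaurentSeries F) (algebraMap F[X] (RatFunc F) p) = ofPoly F p := by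
  change RatFunc.liftRingHom (ofPoly F) _ _ = _
  rw [RatFunc.liftRingHom_algebraMap]

/-- The polynomial part of a series: its terms `a_h z^{-h}` with `h ≤ 0`, as a polynomial in `z`. -/
def polyPart (ξ : InvLaurentSeries F) : F[X] :=
  ∑ n ∈ Finset.range ((-HahnSeries.order ξ.toLaurent).toNat + 1),
    Polynomial.monomial n (ξ.coeff (-(n : ℤ)))

theorem coeff_polyPart (ξ : InvLaurentSeries F) (n : ℕ) :
    ξ.polyPart.coeff n = ξ.coeff (-(n : ℤ)) := by
  simp only [polyPart, Polynomial.finsetSum_coeff, Polynomial.coeff_monomial,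
    Finset.sum_ite_eq', Finset.mem_range]
  split_ifs with h
  · rfl
  · refine (HahnSeries.coeff_eq_zero_of_lt_order ?_).symm
    omega

/-- The complete quotients of the continued fraction algorithm: `ξ_0 = ξ`, and `ξ_{n+1}` is the
inverse of the fractional part of `ξ_n`. -/
def completeQuotient (ξ : InvLaurentSeries F) : ℕ → InvLaurentSeries F
  | 0 => ξ
  | n + 1 => (completeQuotient ξ n - ofPoly F (completeQuotient ξ n).polyPart)⁻¹

/-- The partial quotients of `ξ = [a_0; a_1, a_2, …]`: `a_n` is the polynomial part of `ξ_n`.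
(If the expansion is finite, all further values are `0`, which is not an admissible
partial quotient of positive index.) -/
def partialQuotient (ξ : InvLaurentSeries F) (n : ℕ) : F[X] := (ξ.completeQuotient n).polyPart

end InvLaurentSeries

/-- The Thue–Morse word over `{a, b}`: `t_0 = a`, `t_{2k} = t_k`, and `t_{2k+1}` is the letter
other than `t_k`. The other letter is obtained by exchanging the roles of `a` and `b`. -/
def thueMorse {α : Type*} (a b : α) : ℕ → α
  | 0 => a
  | n + 1 => if (n + 1) % 2 = 0 then thueMorse a b ((n + 1) / 2) else thueMorse b a ((n + 1) / 2)

theorem thueMorse_two_mul {α : Type*} (a b : α) (k : ℕ) :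
    thueMorse a b (2 * k) = thueMorse a b k := by
  cases k with
  | zero => rfl
  | succ k =>
    rw [show 2 * (k + 1) = (2 * k + 1) + 1 by ring, thueMorse, if_pos (by omega)]
    congr 1
    omega

theorem thueMorse_two_mul_add_one {α : Type*} (a b : α) (k : ℕ) :
    thueMorse a b (2 * k + 1) = thueMorse b a k := by
  rw [thueMorse, if_neg (by omega)]
  congr 1
  omega

theorem thueMorse_swap {α : Type*} (a b : α) (k : ℕ) :
    (thueMorse a b k = a ∧ thueMorse b a k = b) ∨ (thueMorse a b k = b ∧ thueMorse b a k = a) := by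
  induction k using Nat.strong_induction_on with
  | _ k ih =>
    obtain ⟨m, rfl | rfl⟩ : ∃ m, k = 2 * m ∨ k = 2 * m + 1 := ⟨k / 2, by omega⟩
    · rcases Nat.eq_zero_or_pos m with rfl | hm
      · left; constructor <;> simp [thueMorse]
      · rw [thueMorse_two_mul, thueMorse_two_mul]; exact ih m (by omega)
    · rw [thueMorse_two_mul_add_one, thueMorse_two_mul_add_one]
      rcases ih m (by omega) with ⟨h1, h2⟩ | ⟨h1, h2⟩
      · exact Or.inr ⟨h2, h1⟩
      · exact Or.inl ⟨h2, h1⟩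

/-- `ξ = [0; t_0, t_1, t_2, …]`, where `t_0 t_1 t_2 …` is the Thue–Morse word over `{a, b}`. -/
def IsThueMorseContFract {F : Type*} [Field F] (a b : F[X]) (ξ : InvLaurentSeries F) : Prop :=
  ξ.partialQuotient 0 = 0 ∧ ∀ n : ℕ, ξ.partialQuotient (n + 1) = thueMorse a b n

end

/-! Existence and uniqueness hold because `δ ↦ 1/(p + δ)` with `p` non-constant is a contraction on
series of order at least 1 (`orderGE_inv_sub_inv`).

For the degree bound, two properties of the Thue–Morse word suffice. It is not eventually periodic,
so degree at most 2 is excluded by Lagrange's theorem (`HasContFract.eventually_periodic`), where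
finiteness of the field enters. Its prefixes of length `4 ^ k` are palindromes, which excludes
degree 3 (`HasContFract.not_cubic`).

In the cubic case, a palindromic prefix makes the convergent matrix symmetric, say with rows `(x,
y)` and `(y, w)`, so `v = (x, y, w)` is close to `x(1, ξ, ξ²)`. The vector `(1, ξ, ξ²)` is an
eigenvector of the companion matrix `M` of the minimal polynomial, so `v`, `Mv`, `M²v` are nearly
proportional. After clearing denominators, their determinant is a polynomial of positive order at
infinity, hence zero. Irreducibility of the cubic then forces `v = 0`, against `xw - y² = ±1`. -/

namespace InvLaurentSeries

variable {F : Type*} [Field F]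

/-! ### Valuation bounds at infinity. -/

/-- `OrderGE m ξ` says that `ξ` only involves the powers `z^{-h}` with `h ≥ m`. -/
def OrderGE (m : ℤ) (ξ : InvLaurentSeries F) : Prop := ∀ h < m, ξ.coeff h = 0

@[ext]
theorem ext {ξ η : InvLaurentSeries F} (h : ∀ n, ξ.coeff n = η.coeff n) : ξ = η :=
  HahnSeries.ext (funext h)

@[simp]
theorem coeff_add (ξ η : InvLaurentSeries F) (h : ℤ) :
    (ξ + η).coeff h = ξ.coeff h + η.coeff h := rfl

@[simp]
theorem coeff_neg (ξ : InvLaurentSeries F) (h : ℤ) : (-ξ).coeff h = -ξ.coeff h := rfl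

@[simp]
theorem coeff_sub (ξ η : InvLaurentSeries F) (h : ℤ) :
    (ξ - η).coeff h = ξ.coeff h - η.coeff h := by
  rw [sub_eq_add_neg, coeff_add, coeff_neg, sub_eq_add_neg]

theorem orderGE_iff {m : ℤ} {ξ : InvLaurentSeries F} :
    OrderGE m ξ ↔ (m : WithTop ℤ) ≤ HahnSeries.orderTop ξ.toLaurent := by
  rw [HahnSeries.le_orderTop_iff_forall]
  simp only [WithTop.coe_lt_coe]
  rfl

namespace OrderGE

theorem mono {m n : ℤ} {ξ : InvLaurentSeries F} (hξ : OrderGE m ξ) (h : n ≤ m) : OrderGE n ξ :=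
  fun k hk => hξ k (hk.trans_le h)

theorem zero (m : ℤ) : OrderGE m (0 : InvLaurentSeries F) := fun _ _ => rfl

theorem add {m : ℤ} {ξ η : InvLaurentSeries F} (hξ : OrderGE m ξ) (hη : OrderGE m η) :
    OrderGE m (ξ + η) := fun k hk => by rw [coeff_add, hξ k hk, hη k hk, add_zero]

theorem neg {m : ℤ} {ξ : InvLaurentSeries F} (hξ : OrderGE m ξ) : OrderGE m (-ξ) :=
  fun k hk => by rw [coeff_neg, hξ k hk, neg_zero]

theorem sub {m : ℤ} {ξ η : InvLaurentSeries F} (hξ : OrderGE m ξ) (hη : OrderGE m η) :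
    OrderGE m (ξ - η) := fun k hk => by rw [coeff_sub, hξ k hk, hη k hk, sub_zero]

theorem mul {m n : ℤ} {ξ η : InvLaurentSeries F} (hξ : OrderGE m ξ) (hη : OrderGE n η) :
    OrderGE (m + n) (ξ * η) := by
  rw [orderGE_iff] at *
  have : HahnSeries.orderTop (ξ * η).toLaurent
      = HahnSeries.orderTop ξ.toLaurent + HahnSeries.orderTop η.toLaurent :=
    HahnSeries.orderTop_mul ξ.toLaurent η.toLaurent
  rw [this, WithTop.coe_add]
  exact add_le_add hξ hη

theorem ofPoly {p : F[X]} {n : ℕ} (hp : p.natDegree ≤ n) : OrderGE (-n) (ofPoly F p) := by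
  intro h hh
  obtain ⟨k, rfl⟩ : ∃ k : ℕ, h = -k := ⟨(-h).toNat, by omega⟩
  rw [coeff_ofPoly, coeff_eq_zero_of_natDegree_lt]
  omega

theorem natDegree_le {p : F[X]} {n : ℕ} (h : OrderGE (-n) (InvLaurentSeries.ofPoly F p)) :
    p.natDegree ≤ n := by
  refine natDegree_le_iff_coeff_eq_zero.2 fun k hk => ?_
  rw [← coeff_ofPoly, h]
  omega

theorem eq_zero_of_pos {p : F[X]} {m : ℤ} (hm : 0 < m)
    (h : OrderGE m (InvLaurentSeries.ofPoly F p)) : p = 0 := by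
  ext n
  rw [← coeff_ofPoly, h _ (by omega), Polynomial.coeff_zero]

theorem inv {m : ℤ} {ξ : InvLaurentSeries F} (h : ξ.coeff m ≠ 0) : OrderGE (-m) ξ⁻¹ := by
  have h0 : ξ ≠ 0 := by rintro rfl; exact h rfl
  have h1 : HahnSeries.orderTop (ξ.toLaurent) ≤ m := HahnSeries.orderTop_le_of_coeff_ne_zero h
  have h2 : HahnSeries.orderTop ξ.toLaurent + HahnSeries.orderTop (ξ⁻¹).toLaurent = 0 := by
    rw [← HahnSeries.orderTop_mul]
    change HahnSeries.orderTop (ξ * ξ⁻¹).toLaurent = 0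
    rw [mul_inv_cancel₀ h0]
    exact HahnSeries.orderTop_one
  rw [orderGE_iff]
  revert h1 h2
  cases HahnSeries.orderTop ξ.toLaurent <;> cases HahnSeries.orderTop (ξ⁻¹).toLaurent <;>
    norm_cast
  · simp
  · simp
  · simp
  · omega

theorem exists_nat (ξ : InvLaurentSeries F) : ∃ m : ℕ, OrderGE (-m) ξ := by
  refine ⟨(-HahnSeries.order ξ.toLaurent).toNat, fun h hh => ?_⟩
  refine HahnSeries.coeff_eq_zero_of_lt_order (x := ξ.toLaurent) ?_
  omega

end OrderGE

theorem eq_zero_of_forall_orderGE {ξ : InvLaurentSeries F} (h : ∀ n : ℕ, OrderGE n ξ) :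
    ξ = 0 := by
  ext k
  exact h (k.toNat + 1) k (by omega)

/-! ### Convergence and uniqueness of continued fractions. -/

/-- A sequence of series whose `n`-th increment only involves `z^{-h}` with `h ≥ n` converges. -/
theorem exists_limit {s : ℕ → InvLaurentSeries F} {m : ℤ} (hm : ∀ n, OrderGE m (s n))
    (hs : ∀ n : ℕ, OrderGE n (s (n + 1) - s n)) : ∃ ξ, ∀ n : ℕ, OrderGE n (ξ - s n) := by
  have hs' : ∀ n k : ℕ, OrderGE n (s (n + k) - s n) := by
    intro n k
    induction k with
    | zero => simpa using OrderGE.zero _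
    | succ k ih =>
      have := (hs (n + k)).mono (n := n) (by push_cast; omega)
      simpa [add_assoc] using this.add ih
  -- From index `h.toNat + 1` on, increments only involve exponents beyond `h`, so the coefficient
  -- of index `h` is final.
  let f : ℤ → F := fun h => (s (h.toNat + 1)).coeff h
  have hf : BddBelow (Function.support f) := by
    refine ⟨m, fun h hh => ?_⟩
    by_contra hlt
    exact hh (hm _ h (by omega))
  let ξ : InvLaurentSeries F := (HahnSeries.ofSuppBddBelow f hf : LaurentSeries F)
  have hξ : ∀ h, ξ.coeff h = f h := fun h => rfl
  refine ⟨ξ, fun n h hh => ?_⟩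
  rw [coeff_sub, hξ, sub_eq_zero]
  rcases le_total (h.toNat + 1) n with hn | hn
  · obtain ⟨k, rfl⟩ := Nat.exists_eq_add_of_le hn
    have := hs' (h.toNat + 1) k h (by push_cast; omega)
    rw [coeff_sub, sub_eq_zero] at this
    exact this.symm
  · obtain ⟨k, hk⟩ := Nat.exists_eq_add_of_le hn
    have := hs' n k h hh
    rw [coeff_sub, sub_eq_zero, ← hk] at this
    exact this

theorem orderGE_sub_polyPart (ξ : InvLaurentSeries F) : OrderGE 1 (ξ - ofPoly F ξ.polyPart) := by
  intro h hh
  obtain ⟨k, rfl⟩ : ∃ k : ℕ, h = -k := ⟨(-h).toNat, by omega⟩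
  rw [coeff_sub, coeff_ofPoly, coeff_polyPart, sub_self]

theorem polyPart_ofPoly_add {p : F[X]} {δ : InvLaurentSeries F} (hδ : OrderGE 1 δ) :
    (ofPoly F p + δ).polyPart = p := by
  ext n
  rw [coeff_polyPart, coeff_add, coeff_ofPoly, hδ _ (by omega), add_zero]

theorem coeff_ofPoly_add_natDegree_ne_zero {p : F[X]} (hp : p ≠ 0) {δ : InvLaurentSeries F}
    (hδ : OrderGE 1 δ) : (ofPoly F p + δ).coeff (-p.natDegree) ≠ 0 := by
  rw [coeff_add, coeff_ofPoly, hδ _ (by omega), add_zero]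
  simpa using hp

theorem ofPoly_add_ne_zero {p : F[X]} (hp : p ≠ 0) {δ : InvLaurentSeries F}
    (hδ : OrderGE 1 δ) : ofPoly F p + δ ≠ 0 := by
  intro h
  apply coeff_ofPoly_add_natDegree_ne_zero hp hδ
  rw [h]
  rfl

theorem orderGE_inv_ofPoly_add {p : F[X]} (hp : p ≠ 0) {δ : InvLaurentSeries F}
    (hδ : OrderGE 1 δ) : OrderGE p.natDegree (ofPoly F p + δ)⁻¹ := by
  simpa using OrderGE.inv (coeff_ofPoly_add_natDegree_ne_zero hp hδ)

/-- The difference of inverses carries two inverse factors, each of order at least `p.natDegree ≥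
1`; hence the gain of 2. This contraction drives both convergence and uniqueness. -/
theorem orderGE_inv_sub_inv {p : F[X]} (hp : 0 < p.natDegree) {δ ε : InvLaurentSeries F}
    (hδ : OrderGE 1 δ) (hε : OrderGE 1 ε) {m : ℤ} (h : OrderGE m (δ - ε)) :
    OrderGE (m + 2) ((ofPoly F p + δ)⁻¹ - (ofPoly F p + ε)⁻¹) := by
  have hp0 : p ≠ 0 := by rintro rfl; simp at hp
  have h1 := ofPoly_add_ne_zero hp0 hδ
  have h2 := ofPoly_add_ne_zero hp0 hε
  have h3 : (ofPoly F p + δ)⁻¹ - (ofPoly F p + ε)⁻¹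
      = -((δ - ε) * ((ofPoly F p + δ)⁻¹ * (ofPoly F p + ε)⁻¹)) := by
    field_simp
    ring
  rw [h3]
  exact ((h.mul ((orderGE_inv_ofPoly_add hp0 hδ).mul (orderGE_inv_ofPoly_add hp0 hε))).mono
    (by omega)).neg

/-- The finite continued fraction `[0; a_0, …, a_{n-1}]`. -/
noncomputable def finiteContFract : ℕ → (ℕ → F[X]) → InvLaurentSeries F
  | 0, _ => 0
  | n + 1, a => (ofPoly F (a 0) + finiteContFract n fun k => a (k + 1))⁻¹

theorem orderGE_finiteContFract {a : ℕ → F[X]} (ha : ∀ n, 0 < (a n).natDegree) (n : ℕ) :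
    OrderGE 1 (finiteContFract n a) := by
  induction n generalizing a with
  | zero => exact OrderGE.zero _
  | succ n ih =>
    have ha0 : a 0 ≠ 0 := by intro h; simpa [h] using ha 0
    exact (orderGE_inv_ofPoly_add ha0 (ih fun n => ha (n + 1))).mono (by have := ha 0; omega)

theorem orderGE_finiteContFract_succ_sub {a : ℕ → F[X]} (ha : ∀ n, 0 < (a n).natDegree) (n : ℕ) :
    OrderGE n (finiteContFract (n + 1) a - finiteContFract n a) := by
  induction n generalizing a with
  | zero =>
    exact ((orderGE_finiteContFract ha 1).sub (orderGE_finiteContFract ha 0)).mono (by simp)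
  | succ n ih =>
    have ha' : ∀ k, 0 < (a (k + 1)).natDegree := fun k => ha (k + 1)
    exact (orderGE_inv_sub_inv (ha 0) (orderGE_finiteContFract ha' (n + 1))
      (orderGE_finiteContFract ha' n) (ih ha')).mono (by push_cast; omega)

/-- Infinite continued fractions converge: there are series `η_k = [0; a_k, a_{k+1}, …]`. -/
theorem exists_tails {a : ℕ → F[X]} (ha : ∀ n, 0 < (a n).natDegree) :
    ∃ η : ℕ → InvLaurentSeries F, ∀ k, OrderGE 1 (η k) ∧ η k = (ofPoly F (a k) + η (k + 1))⁻¹ := by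
  have ha' : ∀ k n, 0 < (a (n + k)).natDegree := fun k n => ha _
  choose η hη using fun k => exists_limit (orderGE_finiteContFract (ha' k))
    (orderGE_finiteContFract_succ_sub (ha' k))
  have h1 : ∀ k, OrderGE 1 (η k) := fun k => by
    simpa using (hη k 1).add (orderGE_finiteContFract (ha' k) 1)
  refine ⟨η, fun k => ⟨h1 k, ?_⟩⟩
  rw [← sub_eq_zero]
  refine eq_zero_of_forall_orderGE fun n => ?_
  have h2 := orderGE_inv_sub_inv (ha k) (h1 (k + 1)) (orderGE_finiteContFract (ha' (k + 1)) n)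
    (hη (k + 1) n)
  have h3 : (ofPoly F (a k) + finiteContFract n fun m => a (m + (k + 1)))⁻¹
      = finiteContFract (n + 1) fun m => a (m + k) := by
    simp only [finiteContFract, zero_add, add_right_comm, add_assoc]
  rw [h3] at h2
  -- Both sides of the recursion agree to order `n` with the same finite continued fraction of
  -- length `n + 1`.
  have h4 := ((hη k (n + 1)).mono (n := n) (by push_cast; omega)).sub
    (h2.mono (n := n) (by omega))
  rwa [sub_sub_sub_cancel_right] at h4

theorem exists_partialQuotient {a : ℕ → F[X]} (ha : ∀ n, 0 < (a n).natDegree) :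
    ∃ ξ : InvLaurentSeries F, ξ.partialQuotient 0 = 0 ∧ ∀ n, ξ.partialQuotient (n + 1) = a n := by
  obtain ⟨η, hη⟩ := exists_tails ha
  have h0 : (η 0).polyPart = 0 := by
    simpa using polyPart_ofPoly_add (p := 0) (hη 0).1
  have h1 : ∀ n, (η 0).completeQuotient (n + 1) = ofPoly F (a n) + η (n + 1) := by
    intro n
    induction n with
    | zero =>
      change (η 0 - ofPoly F (η 0).polyPart)⁻¹ = _
      rw [h0, map_zero, sub_zero, (hη 0).2, inv_inv]
    | succ n ih =>
      rw [completeQuotient, ih, polyPart_ofPoly_add (hη (n + 1)).1, add_sub_cancel_left,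
        (hη (n + 1)).2, inv_inv]
  refine ⟨η 0, h0, fun n => ?_⟩
  rw [partialQuotient, h1, polyPart_ofPoly_add (hη (n + 1)).1]

theorem completeQuotient_eq (ξ : InvLaurentSeries F) (n : ℕ) :
    ξ.completeQuotient n = ofPoly F (ξ.partialQuotient n) + (ξ.completeQuotient (n + 1))⁻¹ := by
  rw [completeQuotient, inv_inv, partialQuotient, add_sub_cancel]

theorem orderGE_inv_completeQuotient_succ (ξ : InvLaurentSeries F) (n : ℕ) :
    OrderGE 1 (ξ.completeQuotient (n + 1))⁻¹ := by
  rw [completeQuotient, inv_inv]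
  exact orderGE_sub_polyPart _

/-- Agreement to order `k` of the fractional parts at level `n + 1` gives agreement to order `k + 1`
at level `n`, because the polynomial parts are equal. -/
theorem eq_of_partialQuotient_eq {ξ η : InvLaurentSeries F}
    (hpos : ∀ n, 0 < (ξ.partialQuotient (n + 1)).natDegree)
    (h : ∀ n, ξ.partialQuotient n = η.partialQuotient n) : ξ = η := by
  have key : ∀ k n : ℕ, OrderGE k
      ((ξ.completeQuotient (n + 1))⁻¹ - (η.completeQuotient (n + 1))⁻¹) := by
    intro k
    induction k with
    | zero =>
      intro n
      exact ((orderGE_inv_completeQuotient_succ ξ n).sub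
        (orderGE_inv_completeQuotient_succ η n)).mono (by simp)
    | succ k ih =>
      intro n
      rw [completeQuotient_eq ξ (n + 1), completeQuotient_eq η (n + 1), ← h]
      exact (orderGE_inv_sub_inv (hpos n) (orderGE_inv_completeQuotient_succ _ _)
        (orderGE_inv_completeQuotient_succ _ _) (ih (n + 1))).mono (by push_cast; omega)
  have h1 := sub_eq_zero.1 (eq_zero_of_forall_orderGE fun k => key k 0)
  change ξ.completeQuotient 0 = η.completeQuotient 0
  rw [completeQuotient_eq ξ 0, completeQuotient_eq η 0, h, h1]

end InvLaurentSeries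

theorem thueMorse_natDegree_pos {F : Type*} [Field F] {a b : F[X]} (ha : 0 < a.natDegree)
    (hb : 0 < b.natDegree) (n : ℕ) : 0 < (thueMorse a b n).natDegree := by
  rcases thueMorse_swap a b n with h | h <;> rw [h.1] <;> assumption

theorem existsUnique_isThueMorseContFract {F : Type*} [Field F] {a b : F[X]}
    (ha : 0 < a.natDegree) (hb : 0 < b.natDegree) :
    ∃! ξ : InvLaurentSeries F, IsThueMorseContFract a b ξ := by
  obtain ⟨ξ, hξ⟩ := InvLaurentSeries.exists_partialQuotient (thueMorse_natDegree_pos ha hb)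
  refine ⟨ξ, hξ, fun η hη => InvLaurentSeries.eq_of_partialQuotient_eq (fun n => ?_) fun n => ?_⟩
  · rw [hη.2]
    exact thueMorse_natDegree_pos ha hb n
  · cases n with
    | zero => rw [hη.1, hξ.1]
    | succ n => rw [hη.2, hξ.2]

/-! ### Combinatorics of the Thue–Morse word. -/

/-- The Thue–Morse word is not eventually periodic. -/
theorem thueMorse_not_periodic {α : Type*} {a b : α} (hab : a ≠ b) {N p : ℕ} (hp : 0 < p)
    (h : ∀ n ≥ N, thueMorse a b (n + p) = thueMorse a b n) : False := by
  have hne : ∀ k, thueMorse a b (2 * k + 1) ≠ thueMorse a b (2 * k) := by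
    intro k
    rw [thueMorse_two_mul, thueMorse_two_mul_add_one]
    rcases thueMorse_swap a b k with ⟨h1, h2⟩ | ⟨h1, h2⟩ <;> rw [h1, h2]
    exacts [hab.symm, hab]
  have hmem : ∀ k, thueMorse a b k = a ∨ thueMorse a b k = b := fun k =>
    (thueMorse_swap a b k).imp And.left And.left
  induction p using Nat.strong_induction_on with
  | _ p ih =>
    -- An even period can be halved by looking at even indices. An odd period moves the pairs `(2k,
    -- 2k+1)` of distinct letters onto the pairs `(2k+1, 2k+2)`, so the word alternates from `N` on;
    -- then `t_{2n} = t_{2n+2}`, that is, `t_n = t_{n+1}`.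
    obtain ⟨m, rfl | rfl⟩ := p.even_or_odd'
    · refine ih m (by omega) (by omega) fun n hn => ?_
      have := h (2 * n) (by omega)
      rwa [← mul_add, thueMorse_two_mul, thueMorse_two_mul] at this
    · have halt : ∀ n ≥ N, thueMorse a b (n + 1) ≠ thueMorse a b n := by
        intro n hn
        obtain ⟨k, rfl | rfl⟩ := n.even_or_odd'
        · exact hne k
        · rw [← h (2 * k + 1) hn, ← h (2 * k + 1 + 1) (by omega)]
          convert hne (k + m + 1) using 2 <;> ring
      have hconst : ∀ n ≥ N, thueMorse a b (n + 1) = thueMorse a b n := by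
        intro n hn
        have h1 := halt (2 * n) (by omega)
        have h2 := halt (2 * n + 1) (by omega)
        rw [← thueMorse_two_mul a b n, ← thueMorse_two_mul a b (n + 1),
          show 2 * (n + 1) = 2 * n + 1 + 1 by ring]
        grind
      exact halt N le_rfl (hconst N le_rfl)

/-- The prefixes of length `4 ^ k` of the Thue–Morse word are palindromes. -/
theorem thueMorse_palindrome {α : Type*} (a b : α) (k i : ℕ) (hi : i < 4 ^ k) :
    thueMorse a b (4 ^ k - 1 - i) = thueMorse a b i := by
  have h0 : ∀ (a b : α) n, thueMorse a b (4 * n) = thueMorse a b n := fun a b n => by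
    rw [show 4 * n = 2 * (2 * n) by ring, thueMorse_two_mul, thueMorse_two_mul]
  have h1 : ∀ (a b : α) n, thueMorse a b (4 * n + 1) = thueMorse b a n := fun a b n => by
    rw [show 4 * n + 1 = 2 * (2 * n) + 1 by ring, thueMorse_two_mul_add_one, thueMorse_two_mul]
  have h2 : ∀ (a b : α) n, thueMorse a b (4 * n + 2) = thueMorse b a n := fun a b n => by
    rw [show 4 * n + 2 = 2 * (2 * n + 1) by ring, thueMorse_two_mul, thueMorse_two_mul_add_one]
  have h3 : ∀ (a b : α) n, thueMorse a b (4 * n + 3) = thueMorse a b n := fun a b n => by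
    rw [show 4 * n + 3 = 2 * (2 * n + 1) + 1 by ring, thueMorse_two_mul_add_one,
      thueMorse_two_mul_add_one]
  -- `h0`–`h3` say that each letter expands to a block of the shape `abba`. This block is itself a
  -- palindrome, so reversal sends position `j` of a block to `3 - j`.
  induction k generalizing a b i with
  | zero => simp at hi; subst hi; rfl
  | succ k ih =>
    rw [pow_succ] at hi ⊢
    obtain ⟨n, j, hj, rfl⟩ : ∃ n j, j < 4 ∧ i = 4 * n + j :=
      ⟨i / 4, i % 4, Nat.mod_lt _ (by norm_num), (Nat.div_add_mod i 4).symm⟩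
    have hn : n < 4 ^ k := by omega
    have hr : 4 ^ k * 4 - 1 - (4 * n + j) = 4 * (4 ^ k - 1 - n) + (3 - j) := by omega
    rw [hr]
    interval_cases j
    · rw [h3, ih _ _ _ hn, add_zero, h0]
    · rw [h2, ih _ _ _ hn, h1]
    · rw [h1, ih _ _ _ hn, h2]
    · rw [Nat.sub_self, add_zero, h0, ih _ _ _ hn, h3]

/-! ### Convergents and their approximation quality. -/

/-- The product of the matrices `!![a i, 1; 1, 0]` for `i < n`. Its columns hold the
denominators and numerators of two consecutive convergents of `[0; a 0, a 1, …]`. -/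
def convergentMatrix {R : Type*} [CommRing R] (a : ℕ → R) : ℕ → Matrix (Fin 2) (Fin 2) R
  | 0 => 1
  | n + 1 => convergentMatrix a n * !![a n, 1; 1, 0]

section ConvergentMatrix

variable {R : Type*} [CommRing R] (a : ℕ → R)

theorem convergentMatrix_succ_apply_zero (n : ℕ) (i : Fin 2) :
    convergentMatrix a (n + 1) i 0 = convergentMatrix a n i 0 * a n + convergentMatrix a n i 1 := by
  simp [convergentMatrix, Matrix.mul_apply, Fin.sum_univ_two]

theorem convergentMatrix_succ_apply_one (n : ℕ) (i : Fin 2) :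
    convergentMatrix a (n + 1) i 1 = convergentMatrix a n i 0 := by
  simp [convergentMatrix, Matrix.mul_apply, Fin.sum_univ_two]

theorem det_convergentMatrix (n : ℕ) : (convergentMatrix a n).det = (-1) ^ n := by
  induction n with
  | zero => simp [convergentMatrix]
  | succ n ih => rw [convergentMatrix, Matrix.det_mul, ih, Matrix.det_fin_two_of]; ring

/-- Squaring removes the parity-dependent sign. -/
theorem convergentMatrix_det_sq (n : ℕ) :
    (convergentMatrix a n 0 0 * convergentMatrix a n 1 1
      - convergentMatrix a n 0 1 * convergentMatrix a n 1 0) ^ 2 = 1 := by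
  rw [← Matrix.det_fin_two, det_convergentMatrix, ← pow_mul, mul_comm, pow_mul]
  simp

theorem convergentMatrix_eq_prod (n : ℕ) :
    convergentMatrix a n = ((List.range n).map fun i => !![a i, 1; 1, 0]).prod := by
  induction n with
  | zero => rfl
  | succ n ih => rw [convergentMatrix, List.range_succ, List.map_append, List.prod_append, ih]; simp

/-- Each factor is symmetric, so transposition reverses the product, and a palindrome is unchanged
by reversal. -/
theorem convergentMatrix_symm {n : ℕ} (h : ∀ i < n, a (n - 1 - i) = a i) :
    convergentMatrix a n 0 1 = convergentMatrix a n 1 0 := by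
  have key : (convergentMatrix a n).transpose = convergentMatrix a n := by
    rw [convergentMatrix_eq_prod, Matrix.transpose_list_prod]
    congr 1
    rw [List.map_map, ← List.map_reverse]
    refine List.ext_getElem (by simp) fun i h1 h2 => ?_
    have hi : i < n := by simpa using h2
    simp only [List.getElem_map, List.getElem_reverse, List.getElem_range, List.length_range,
      Function.comp_apply, h i hi]
    ext j k
    fin_cases j <;> fin_cases k <;> rfl
  exact congrFun (congrFun key 1) 0

end ConvergentMatrix

namespace InvLaurentSeries

variable {F : Type*} [Field F]

theorem natDegree_convergentMatrix_le (a : ℕ → F[X]) (n : ℕ) (i j : Fin 2) :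
    (convergentMatrix a n i j).natDegree ≤ ∑ k ∈ Finset.range n, (a k).natDegree := by
  induction n generalizing i j with
  | zero =>
    change ((1 : Matrix (Fin 2) (Fin 2) F[X]) i j).natDegree ≤ _
    rw [Matrix.one_apply]
    split_ifs <;> simp
  | succ n ih =>
    rw [Finset.sum_range_succ]
    fin_cases j
    · change (convergentMatrix a (n + 1) i 0).natDegree ≤ _
      rw [convergentMatrix_succ_apply_zero]
      refine (natDegree_add_le _ _).trans (max_le ?_ ?_)
      · exact natDegree_mul_le.trans (Nat.add_le_add_right (ih _ _) _)
      · exact (ih _ _).trans (Nat.le_add_right _ _)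
    · change (convergentMatrix a (n + 1) i 1).natDegree ≤ _
      rw [convergentMatrix_succ_apply_one]
      exact (ih _ _).trans (Nat.le_add_right _ _)

/-- `ξ = [0; a 0, a 1, …]` with non-constant partial quotients `a n`. -/
structure HasContFract (ξ : InvLaurentSeries F) (a : ℕ → F[X]) : Prop where
  zero : ξ.partialQuotient 0 = 0
  succ : ∀ n, ξ.partialQuotient (n + 1) = a n
  pos : ∀ n, 0 < (a n).natDegree

namespace HasContFract

variable {ξ : InvLaurentSeries F} {a : ℕ → F[X]}

theorem completeQuotient_succ (h : HasContFract ξ a) (n : ℕ) : ξ.completeQuotient (n + 1) =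
    ofPoly F (a n) + (ξ.completeQuotient (n + 2))⁻¹ := by
  rw [completeQuotient_eq, h.succ]

theorem completeQuotient_ne_zero (h : HasContFract ξ a) (n : ℕ) :
    ξ.completeQuotient (n + 1) ≠ 0 := by
  rw [h.completeQuotient_succ]
  refine ofPoly_add_ne_zero ?_ (orderGE_inv_completeQuotient_succ ξ (n + 1))
  intro h0
  simpa [h0] using h.pos n

theorem orderGE_inv (h : HasContFract ξ a) (n : ℕ) :
    OrderGE (a n).natDegree (ξ.completeQuotient (n + 1))⁻¹ := by
  rw [h.completeQuotient_succ]
  refine orderGE_inv_ofPoly_add ?_ (orderGE_inv_completeQuotient_succ ξ (n + 1))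
  intro h0
  simpa [h0] using h.pos n

theorem eq_inv (h : HasContFract ξ a) : ξ = (ξ.completeQuotient 1)⁻¹ := by
  have := completeQuotient_eq ξ 0
  rwa [h.zero, map_zero, zero_add] at this

theorem le_sum_natDegree (h : HasContFract ξ a) (n : ℕ) :
    n ≤ ∑ k ∈ Finset.range n, (a k).natDegree := by
  have := Finset.card_nsmul_le_sum (Finset.range n) (fun k => (a k).natDegree) 1 fun k _ => h.pos k
  rwa [Finset.card_range, smul_eq_mul, mul_one] at this

/-- The approximation quality of the convergents. -/
theorem orderGE_convergent (h : HasContFract ξ a) (n : ℕ) :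
    ((ofPoly F (convergentMatrix a n 0 0) * ξ - ofPoly F (convergentMatrix a n 1 0))
        * ξ.completeQuotient (n + 1)
      + (ofPoly F (convergentMatrix a n 0 1) * ξ - ofPoly F (convergentMatrix a n 1 1)) = 0) ∧
    OrderGE (∑ k ∈ Finset.range (n + 1), (a k).natDegree : ℕ)
      (ofPoly F (convergentMatrix a n 0 0) * ξ - ofPoly F (convergentMatrix a n 1 0)) ∧
    OrderGE (∑ k ∈ Finset.range n, (a k).natDegree : ℕ)
      (ofPoly F (convergentMatrix a n 0 1) * ξ - ofPoly F (convergentMatrix a n 1 1)) := by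
  induction n with
  | zero =>
    have h1 : OrderGE 0 (-1 : InvLaurentSeries F) := by
      simpa using (OrderGE.ofPoly (p := (1 : F[X])) (n := 0) (by simp)).neg
    have h2 : ξ * ξ.completeQuotient 1 = 1 := by
      conv_lhs => enter [1]; rw [h.eq_inv]
      exact inv_mul_cancel₀ (h.completeQuotient_ne_zero 0)
    have h3 := h.orderGE_inv 0
    rw [zero_add, ← h.eq_inv] at h3
    simp [convergentMatrix, h1, h2, h3]
  | succ n ih =>
    obtain ⟨h1, h2, h3⟩ := ih
    have h4 := h.completeQuotient_succ n
    have h5 := h.completeQuotient_ne_zero (n + 1)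
    simp only [convergentMatrix_succ_apply_zero, convergentMatrix_succ_apply_one, map_add, map_mul]
    set e := ofPoly F (convergentMatrix a n 0 0) * ξ - ofPoly F (convergentMatrix a n 1 0)
    set e' := ofPoly F (convergentMatrix a n 0 1) * ξ - ofPoly F (convergentMatrix a n 1 1)
    -- The errors satisfy the recurrence of the convergents. Eliminating `e'` through `h1` leaves
    -- `e` divided by the next complete quotient, which gains the degree of `a (n + 1)`.
    have h6 : (ofPoly F (convergentMatrix a n 0 0) * ofPoly F (a n)
        + ofPoly F (convergentMatrix a n 0 1)) * ξ
        - (ofPoly F (convergentMatrix a n 1 0) * ofPoly F (a n)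
          + ofPoly F (convergentMatrix a n 1 1)) = -(e * (ξ.completeQuotient (n + 2))⁻¹) := by
      rw [h4] at h1
      linear_combination h1
    rw [h6]
    refine ⟨?_, ?_, h2⟩
    · rw [neg_mul, inv_mul_cancel_right₀ h5, neg_add_cancel]
    · rw [Finset.sum_range_succ, Nat.cast_add]
      exact (h2.mul (h.orderGE_inv (n + 1))).neg

end HasContFract

/-! ### Lagrange's theorem: the quadratic case. -/

theorem OrderGE.exists_nat₂ (ξ η : InvLaurentSeries F) :
    ∃ m : ℕ, OrderGE (-m) ξ ∧ OrderGE (-m) η := by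
  obtain ⟨k, hk⟩ := OrderGE.exists_nat ξ
  obtain ⟨l, hl⟩ := OrderGE.exists_nat η
  exact ⟨k + l, hk.mono (by push_cast; omega), hl.mono (by push_cast; omega)⟩

/-- The roots of the nonzero polynomials of degree at most two with coefficients in `F[z]` of
degree at most `m` form a finite set. -/
theorem finite_setOf_quadratic_roots [Finite F] (m : ℕ) : {ζ : InvLaurentSeries F |
    ∃ A B C : F[X], A.natDegree ≤ m ∧ B.natDegree ≤ m ∧ C.natDegree ≤ m ∧
      ¬(A = 0 ∧ B = 0 ∧ C = 0) ∧ ofPoly F A * ζ ^ 2 + ofPoly F B * ζ + ofPoly F C = 0}.Finite := by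
  have hfin : {p : F[X] | p.natDegree ≤ m}.Finite := by
    have : Finite (degreeLT F (m + 1)) := Finite.of_equiv _ (degreeLTEquiv F (m + 1)).symm.toEquiv
    refine (Set.toFinite (degreeLT F (m + 1) : Set F[X])).subset fun p hp => ?_
    exact mem_degreeLT.2 ((natDegree_le_iff_degree_le.1 hp).trans_lt (by norm_cast; omega))
  classical
  let q : F[X] × F[X] × F[X] → (InvLaurentSeries F)[X] := fun t =>
    Polynomial.C (ofPoly F t.1) * X ^ 2 + Polynomial.C (ofPoly F t.2.1) * X
      + Polynomial.C (ofPoly F t.2.2)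
  refine ((hfin.prod (hfin.prod hfin)).biUnion fun t _ =>
    (q t).roots.toFinset.finite_toSet).subset ?_
  rintro ζ ⟨A, B, C, hA, hB, hC, h0, h⟩
  refine Set.mem_biUnion (x := (A, B, C)) ⟨hA, hB, hC⟩ ?_
  have hq : q (A, B, C) ≠ 0 := by
    intro hq
    apply h0
    have hz : ∀ p : F[X], ofPoly F p = 0 → p = 0 := fun p =>
      (map_eq_zero_iff _ ofPoly_injective).1
    have e2 := congrArg (fun p => p.coeff 2) hq
    have e1 := congrArg (fun p => p.coeff 1) hq
    have e0 := congrArg (fun p => p.coeff 0) hq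
    simp [q, Polynomial.coeff_X, Polynomial.coeff_C] at e0 e1 e2
    exact ⟨hz _ e2, hz _ e1, hz _ e0⟩
  simp only [Finset.mem_coe, Multiset.mem_toFinset]
  rw [mem_roots hq]
  simpa [q] using h

/-- The function field version of Lagrange's theorem: if `ξ` is a root of a nonzero polynomial of
degree at most two then its continued fraction expansion is eventually periodic. -/
theorem HasContFract.eventually_periodic [Finite F] {ξ : InvLaurentSeries F} {a : ℕ → F[X]}
    (h : HasContFract ξ a) {c₀ c₁ c₂ : F[X]} (hc : ¬(c₀ = 0 ∧ c₁ = 0 ∧ c₂ = 0))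
    (hξ : ofPoly F c₂ * ξ ^ 2 + ofPoly F c₁ * ξ + ofPoly F c₀ = 0) :
    ∃ N p : ℕ, 0 < p ∧ ∀ n ≥ N, a (n + p) = a n := by
  obtain ⟨m, hm₁, hm₂⟩ := OrderGE.exists_nat₂ (ofPoly F c₂)
    (2 * ofPoly F c₂ * ξ + ofPoly F c₁)
  have key : ∀ n, ξ.completeQuotient (n + 1) ∈ {ζ : InvLaurentSeries F |
    ∃ A B C : F[X], A.natDegree ≤ m ∧ B.natDegree ≤ m ∧ C.natDegree ≤ m ∧
      ¬(A = 0 ∧ B = 0 ∧ C = 0) ∧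
      ofPoly F A * ζ ^ 2 + ofPoly F B * ζ + ofPoly F C = 0} := by
    intro n
    obtain ⟨h1, h2, h3⟩ := h.orderGE_convergent n
    have hx := OrderGE.ofPoly (natDegree_convergentMatrix_le a n 0 0)
    have hy := OrderGE.ofPoly (natDegree_convergentMatrix_le a n 0 1)
    have hdet := convergentMatrix_det_sq a n
    rw [Finset.sum_range_succ] at h2
    replace h2 := h2.mono (n := ((∑ k ∈ Finset.range n, (a k).natDegree : ℕ) : ℤ))
      (by push_cast; omega)
    generalize (∑ k ∈ Finset.range n, (a k).natDegree) = D at *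
    generalize convergentMatrix a n 0 0 = x at *
    generalize convergentMatrix a n 0 1 = y at *
    generalize convergentMatrix a n 1 0 = z at *
    generalize convergentMatrix a n 1 1 = w at *
    generalize ξ.completeQuotient (n + 1) = ζ at *
    obtain ⟨e, he⟩ : ∃ e, e = ofPoly F x * ξ - ofPoly F z := ⟨_, rfl⟩
    obtain ⟨e', he'⟩ : ∃ e', e' = ofPoly F y * ξ - ofPoly F w := ⟨_, rfl⟩
    rw [← he, ← he'] at h1
    rw [← he] at h2
    rw [← he'] at h3
    have hz : ofPoly F z = ofPoly F x * ξ - e := by rw [he]; ring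
    have hw : ofPoly F w = ofPoly F y * ξ - e' := by rw [he']; ring
    -- These are the coefficients of the quadratic form after the substitution `ξ = (zζ + w)/(xζ +
    -- y)`. Once `z` and `w` are written through the errors, `hξ` removes the error-free terms;
    -- errors of order at least `D` offset `x` and `y` of degree at most `D`, so the bound `m` is
    -- uniform in `n`.
    refine ⟨c₂ * z ^ 2 + c₁ * z * x + c₀ * x ^ 2,
      2 * c₂ * z * w + c₁ * (z * y + w * x) + 2 * c₀ * x * y,
      c₂ * w ^ 2 + c₁ * w * y + c₀ * y ^ 2, ?_, ?_, ?_, ?_, ?_⟩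
    · refine OrderGE.natDegree_le ?_
      have e1 : ofPoly F (c₂ * z ^ 2 + c₁ * z * x + c₀ * x ^ 2)
          = ofPoly F c₂ * (e * e)
            - (2 * ofPoly F c₂ * ξ + ofPoly F c₁) * (ofPoly F x * e) := by
        simp only [map_add, map_mul, map_pow, hz]
        linear_combination ofPoly F x ^ 2 * hξ
      rw [e1]
      exact ((hm₁.mul (h2.mul h2)).mono (by omega)).sub ((hm₂.mul (hx.mul h2)).mono (by omega))
    · refine OrderGE.natDegree_le ?_
      have e1 : ofPoly F (2 * c₂ * z * w + c₁ * (z * y + w * x) + 2 * c₀ * x * y)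
          = ofPoly F c₂ * (e * e') + ofPoly F c₂ * (e * e')
            - (2 * ofPoly F c₂ * ξ + ofPoly F c₁) * (ofPoly F x * e' + ofPoly F y * e) := by
        simp only [map_add, map_mul, map_ofNat, hz, hw]
        linear_combination 2 * ofPoly F x * ofPoly F y * hξ
      rw [e1]
      exact (((hm₁.mul (h2.mul h3)).add (hm₁.mul (h2.mul h3))).mono (by omega)).sub
        ((hm₂.mul ((hx.mul h3).add (hy.mul h2))).mono (by omega))
    · refine OrderGE.natDegree_le ?_
      have e1 : ofPoly F (c₂ * w ^ 2 + c₁ * w * y + c₀ * y ^ 2)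
          = ofPoly F c₂ * (e' * e')
            - (2 * ofPoly F c₂ * ξ + ofPoly F c₁) * (ofPoly F y * e') := by
        simp only [map_add, map_mul, map_pow, hw]
        linear_combination ofPoly F y ^ 2 * hξ
      rw [e1]
      exact ((hm₁.mul (h3.mul h3)).mono (by omega)).sub ((hm₂.mul (hy.mul h3)).mono (by omega))
    -- The substitution has determinant `±1`; inverting it recovers the original coefficients.
    · rintro ⟨hA, hB, hC⟩
      refine hc ⟨?_, ?_, ?_⟩
      · linear_combination w ^ 2 * hA - w * z * hB + z ^ 2 * hC - c₀ * hdet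
      · linear_combination -2 * y * w * hA + (y * z + w * x) * hB - 2 * x * z * hC - c₁ * hdet
      · linear_combination y ^ 2 * hA - y * x * hB + x ^ 2 * hC - c₂ * hdet
    · simp only [map_add, map_mul, map_pow, map_ofNat, hz, hw]
      have e2 : e' = -(e * ζ) := by linear_combination h1
      rw [e2]
      linear_combination (ofPoly F x * ζ + ofPoly F y) ^ 2 * hξ
  -- All complete quotients lie in one finite set, so two coincide, and each determines its
  -- successors.
  have hinj : ¬Function.Injective fun n => ξ.completeQuotient (n + 1) := fun hinj =>
    Set.infinite_of_injective_forall_mem hinj key (finite_setOf_quadratic_roots m)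
  obtain ⟨k, l, hkl, hlt⟩ : ∃ k l, ξ.completeQuotient (k + 1) = ξ.completeQuotient (l + 1) ∧
      k < l := by
    simp only [Function.Injective, not_forall] at hinj
    obtain ⟨k, l, h1, h2⟩ := hinj
    rcases lt_or_gt_of_ne h2 with h3 | h3
    exacts [⟨k, l, h1, h3⟩, ⟨l, k, h1.symm, h3⟩]
  have hper : ∀ j, ξ.completeQuotient (k + j + 1) = ξ.completeQuotient (l + j + 1) := by
    intro j
    induction j with
    | zero => exact hkl
    | succ j ih =>
      change (ξ.completeQuotient (k + j + 1) - ofPoly F (ξ.completeQuotient (k + j + 1)).polyPart)⁻¹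
        = (ξ.completeQuotient (l + j + 1) - ofPoly F (ξ.completeQuotient (l + j + 1)).polyPart)⁻¹
      rw [ih]
  refine ⟨k, l - k, by omega, fun n hn => ?_⟩
  rw [← h.succ, ← h.succ, partialQuotient, partialQuotient]
  have := hper (n - k)
  rw [show k + (n - k) = n by omega, show l + (n - k) = n + (l - k) by omega] at this
  rw [this]

end InvLaurentSeries

/-! ### Palindromic prefixes: the cubic case. -/

/-- If the cubic `c X³ + c₂ X² + c₁ X + c₀` is irreducible and `M` is `c` times its companion
matrix, then `v`, `M v`, `M² v` are linearly independent for every vector `v = (x, y, w) ≠ 0`. -/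
theorem eq_zero_of_det_companion_orbit_eq_zero {K : Type*} [Field K] {c c₀ c₁ c₂ x y w r s : K}
    (hc : c ≠ 0) (hirr : Irreducible (C c * X ^ 3 + C c₂ * X ^ 2 + C c₁ * X + C c₀))
    (hr : r = -(c₂ * w + c₁ * y + c₀ * x)) (hs : s = -(c₂ * r + c₁ * (c * w) + c₀ * (c * y)))
    (hdet : !![x, y, w; c * y, c * w, r; c ^ 2 * w, c * r, s].det = 0) :
    x = 0 ∧ y = 0 ∧ w = 0 := by
  set f := C c * X ^ 3 + C c₂ * X ^ 2 + C c₁ * X + C c₀ with hf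
  let M : Matrix (Fin 3) (Fin 3) K := !![0, 1, 0; 0, 0, 1; -(c₀ / c), -(c₁ / c), -(c₂ / c)]
  have hfM : aeval M f = 0 := by
    simp only [hf, map_add, map_mul, aeval_C, aeval_X, map_pow, Algebra.algebraMap_eq_smul_one]
    ext i j
    fin_cases i <;> fin_cases j <;>
      simp [M, pow_succ] <;> field_simp <;> ring
  -- A relation between the rows says that `h(M)` kills `v`, with `h` nonzero of degree at most 2,
  -- hence coprime to `f`. As `f(M) = 0`, Bézout makes `h(M)` invertible.
  obtain ⟨g, hg0, hg⟩ := Matrix.exists_vecMul_eq_zero_iff.2 hdet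
  let h : K[X] := C (g 2 * c ^ 2) * X ^ 2 + C (g 1 * c) * X + C (g 0)
  have hh0 : h ≠ 0 := by
    intro hh
    apply hg0
    have e2 := congrArg (fun p => p.coeff 2) hh
    have e1 := congrArg (fun p => p.coeff 1) hh
    have e0 := congrArg (fun p => p.coeff 0) hh
    simp [h, Polynomial.coeff_X, Polynomial.coeff_C, hc, -map_mul] at e0 e1 e2
    ext i
    fin_cases i
    exacts [e0, e1, e2]
  have hcop : IsCoprime f h := by
    refine hirr.coprime_iff_not_dvd.2 fun hdvd => ?_
    have h1 := natDegree_le_of_dvd hdvd hh0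
    have h2 : f.natDegree = 3 := natDegree_cubic hc
    have h3 : h.natDegree ≤ 2 := natDegree_quadratic_le
    omega
  have hhM : (aeval M h).mulVec ![x, y, w] = 0 := by
    have g0 := congrFun hg 0
    have g1 := congrFun hg 1
    have g2 := congrFun hg 2
    simp [Matrix.vecMul, dotProduct, Fin.sum_univ_three] at g0 g1 g2
    simp only [h, map_add, map_mul, aeval_C, aeval_X, map_pow, Algebra.algebraMap_eq_smul_one]
    ext i
    fin_cases i <;>
      simp [M, pow_succ, Fin.sum_univ_three, Matrix.mulVec, dotProduct]
    · linear_combination g0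
    · rw [hr] at g1
      field_simp
      linear_combination g1
    · rw [hs, hr] at g2
      field_simp
      linear_combination g2
  obtain ⟨u, t, hut⟩ := hcop
  have hv : ![x, y, w] = 0 := by
    have h1 := congrArg (aeval M) hut
    rw [map_add, map_mul, map_mul, hfM, mul_zero, zero_add, map_one] at h1
    rw [← Matrix.one_mulVec ![x, y, w], ← h1, ← Matrix.mulVec_mulVec, hhM, Matrix.mulVec_zero]
  exact ⟨congrFun hv 0, congrFun hv 1, congrFun hv 2⟩

namespace InvLaurentSeries

variable {F : Type*} [Field F]

/-- A series whose continued fraction expansion has arbitrarily long palindromic prefixes is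
not cubic. -/
theorem HasContFract.not_cubic {ξ : InvLaurentSeries F} {a : ℕ → F[X]} (h : HasContFract ξ a)
    (hpal : ∀ N, ∃ n ≥ N, ∀ i < n, a (n - 1 - i) = a i) {c c₀ c₁ c₂ : F[X]} (hc : c ≠ 0)
    (hirr : Irreducible (C (algebraMap F[X] (RatFunc F) c) * X ^ 3
      + C (algebraMap F[X] (RatFunc F) c₂) * X ^ 2 + C (algebraMap F[X] (RatFunc F) c₁) * X
      + C (algebraMap F[X] (RatFunc F) c₀)))
    (hξ : ofPoly F c * ξ ^ 3 + ofPoly F c₂ * ξ ^ 2 + ofPoly F c₁ * ξ + ofPoly F c₀ = 0) :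
    False := by
  choose m hm using fun η : InvLaurentSeries F => OrderGE.exists_nat η
  set k : InvLaurentSeries F := ofPoly F c with hk
  set k₀ : InvLaurentSeries F := ofPoly F c₀ with hk₀
  set k₁ : InvLaurentSeries F := ofPoly F c₁ with hk₁
  set k₂ : InvLaurentSeries F := ofPoly F c₂ with hk₂
  -- the coefficients of the two errors in the columns of the determinant
  let u : Fin 3 → InvLaurentSeries F := ![1, -(k * ξ), -(k * k₁)]
  let u' : Fin 3 → InvLaurentSeries F := ![0, k, -(k * (k₂ + k * ξ))]
  let t : Fin 3 → InvLaurentSeries F := ![0, -(k₁ + k * ξ ^ 2), k₂ * k₁ - k₀ * k]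
  let t' : Fin 3 → InvLaurentSeries F := ![1, -k₂, k₂ ^ 2 - k₁ * k - ξ ^ 2 * k ^ 2]
  let l : Fin 3 → InvLaurentSeries F := ![1, k * ξ, k ^ 2 * ξ ^ 2]
  let l' : Fin 3 → InvLaurentSeries F := ![0, k, 0]
  let l'' : Fin 3 → InvLaurentSeries F := ![0, 0, k ^ 2]
  obtain ⟨B, hB⟩ : ∃ B : ℕ, ∀ i, OrderGE (-B) (u i) ∧ OrderGE (-B) (u' i) ∧ OrderGE (-B) (t i) ∧
      OrderGE (-B) (t' i) ∧ OrderGE (-B) (l i) ∧ OrderGE (-B) (l' i) ∧ OrderGE (-B) (l'' i) := by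
    refine ⟨∑ i, (m (u i) + m (u' i) + m (t i) + m (t' i) + m (l i) + m (l' i) + m (l'' i)),
      fun i => ?_⟩
    have := Finset.single_le_sum (f := fun i =>
      m (u i) + m (u' i) + m (t i) + m (t' i) + m (l i) + m (l' i) + m (l'' i))
      (fun _ _ => Nat.zero_le _) (Finset.mem_univ i)
    refine ⟨(hm _).mono ?_, (hm _).mono ?_, (hm _).mono ?_, (hm _).mono ?_, (hm _).mono ?_,
      (hm _).mono ?_, (hm _).mono ?_⟩ <;> omega
  obtain ⟨M, hM⟩ := OrderGE.exists_nat ξ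
  -- In the determinant one factor has order at least `-D - B` and two have order at least `D - M -
  -- B`. The total is `D - 2M - 3B`, positive since `D ≥ n`.
  obtain ⟨n, hn, hp⟩ := hpal (2 * M + 3 * B + 1)
  have hD := h.le_sum_natDegree n
  obtain ⟨-, h2, h3⟩ := h.orderGE_convergent n
  have hx := OrderGE.ofPoly (natDegree_convergentMatrix_le a n 0 0)
  have hdet := convergentMatrix_det_sq a n
  rw [Finset.sum_range_succ] at h2
  replace h2 := h2.mono (n := ((∑ k ∈ Finset.range n, (a k).natDegree : ℕ) : ℤ))
    (by push_cast; omega)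
  rw [← convergentMatrix_symm a hp] at h2 hdet
  generalize (∑ k ∈ Finset.range n, (a k).natDegree) = D at *
  generalize convergentMatrix a n 0 0 = x at *
  generalize convergentMatrix a n 0 1 = y at *
  generalize convergentMatrix a n 1 1 = w at *
  -- `r` and `s` are the last entries of `c` and `c ^ 2` times the first and second companion images
  -- of `(x, y, w)`; the scaling keeps them polynomial.
  obtain ⟨r, hr⟩ : ∃ r, r = -(c₂ * w + c₁ * y + c₀ * x) := ⟨_, rfl⟩
  obtain ⟨s, hs⟩ : ∃ s, s = -(c₂ * r + c₁ * (c * w) + c₀ * (c * y)) := ⟨_, rfl⟩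
  obtain ⟨e, he⟩ : ∃ e, e = ofPoly F y - ofPoly F x * ξ := ⟨_, rfl⟩
  obtain ⟨e', he'⟩ : ∃ e', e' = ofPoly F w - ofPoly F x * ξ ^ 2 := ⟨_, rfl⟩
  have ho : OrderGE (D - M) e := by
    rw [he, ← neg_sub (ofPoly F x * ξ)]
    exact (h2.mono (by omega)).neg
  have ho' : OrderGE (D - M) e' := by
    have : e' = -((ofPoly F x * ξ - ofPoly F y) * ξ + (ofPoly F y * ξ - ofPoly F w)) := by
      rw [he']; ring
    rw [this]
    exact (((h2.mul hM).mono (by omega)).add (h3.mono (by omega))).neg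
  have hy : ofPoly F y = ofPoly F x * ξ + e := by rw [he]; ring
  have hw : ofPoly F w = ofPoly F x * ξ ^ 2 + e' := by rw [he']; ring
  have hcol : ∀ i, OrderGE (-D - B) (l i * ofPoly F x + l' i * e + l'' i * e') := fun i => by
    obtain ⟨-, -, -, -, b1, b2, b3⟩ := hB i
    exact (((b1.mul hx).mono (by omega)).add ((b2.mul ho).mono (by omega))).add
      ((b3.mul ho').mono (by omega))
  have hcol₁ : ∀ i, OrderGE (D - M - B) (u i * e + u' i * e') := fun i => by
    obtain ⟨b1, b2, -⟩ := hB i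
    exact ((b1.mul ho).mono (by omega)).add ((b2.mul ho').mono (by omega))
  have hcol₂ : ∀ i, OrderGE (D - M - B) (t i * e + t' i * e') := fun i => by
    obtain ⟨-, -, b1, b2, -⟩ := hB i
    exact ((b1.mul ho).mono (by omega)).add ((b2.mul ho').mono (by omega))
  have hzero : !![x, y, w; c * y, c * w, r; c ^ 2 * w, c * r, s].det = 0 := by
    refine OrderGE.eq_zero_of_pos (m := 1) one_pos ?_
    -- `L` is the first column. Subtracting `ξ` and `ξ²` times it from the other two leaves `U` and
    -- `T`, which involve only the errors because `(1, ξ, ξ²)` is an eigenvector.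
    obtain ⟨L, hL⟩ : ∃ L : Fin 3 → InvLaurentSeries F,
      L = fun i => l i * ofPoly F x + l' i * e + l'' i * e' := ⟨_, rfl⟩
    obtain ⟨U, hU⟩ : ∃ U : Fin 3 → InvLaurentSeries F, U = fun i => u i * e + u' i * e' := ⟨_, rfl⟩
    obtain ⟨T, hT⟩ : ∃ T : Fin 3 → InvLaurentSeries F, T = fun i => t i * e + t' i * e' := ⟨_, rfl⟩
    have hprod : ∀ i j q, OrderGE 1 (L i * (U j * T q)) := fun i j q => by
      rw [hL, hU, hT]
      exact ((hcol i).mul ((hcol₁ j).mul (hcol₂ q))).mono (by omega)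
    have hexp : ofPoly F (!![x, y, w; c * y, c * w, r; c ^ 2 * w, c * r, s].det)
        = L 0 * (U 1 * T 2) - L 0 * (U 2 * T 1) - L 1 * (U 0 * T 2) + L 1 * (U 2 * T 0)
          + L 2 * (U 0 * T 1) - L 2 * (U 1 * T 0) := by
      have hR : ofPoly F r = k * ξ ^ 3 * ofPoly F x - k₂ * e' - k₁ * e := by
        simp only [hr, map_neg, map_add, map_mul, hy, hw]
        linear_combination -ofPoly F x * hξ
      have hS : ofPoly F s = k ^ 2 * ξ ^ 4 * ofPoly F x + k₂ * (k₂ * e' + k₁ * e)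
          - k₁ * k * e' - k₀ * k * e := by
        simp only [hs, map_neg, map_add, map_mul, hy, hw, hR]
        linear_combination -ofPoly F x * ξ * k * hξ
      have hL0 : ofPoly F x = L 0 := by simp [hL, l, l', l'']
      have hL1 : k * ofPoly F y = L 1 := by simp [hL, l, l', l'', hy]; ring
      have hL2 : k ^ 2 * ofPoly F w = L 2 := by simp [hL, l, l', l'', hw]; ring
      have hU0 : ofPoly F y = L 0 * ξ + U 0 := by rw [← hL0]; simp [hU, u, u', hy]
      have hU1 : k * ofPoly F w = L 1 * ξ + U 1 := by
        rw [← hL1]; simp [hU, u, u', hy, hw]; ring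
      have hU2 : k * ofPoly F r = L 2 * ξ + U 2 := by
        rw [← hL2]; simp [hU, u, u', hR, hw]; ring
      have hT0 : ofPoly F w = L 0 * ξ ^ 2 + T 0 := by rw [← hL0]; simp [hT, t, t', hw]
      have hT1 : ofPoly F r = L 1 * ξ ^ 2 + T 1 := by
        rw [← hL1]; simp [hT, t, t', hy, hR]; ring
      have hT2 : ofPoly F s = L 2 * ξ ^ 2 + T 2 := by
        rw [← hL2]; simp [hT, t, t', hw, hS]; ring
      have hd : ofPoly F (!![x, y, w; c * y, c * w, r; c ^ 2 * w, c * r, s].det)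
          = ofPoly F x * (k * ofPoly F w) * ofPoly F s - ofPoly F x * ofPoly F r * (k * ofPoly F r)
            - ofPoly F y * (k * ofPoly F y) * ofPoly F s
            + ofPoly F y * ofPoly F r * (k ^ 2 * ofPoly F w)
            + ofPoly F w * (k * ofPoly F y) * (k * ofPoly F r)
            - ofPoly F w * (k * ofPoly F w) * (k ^ 2 * ofPoly F w) := by
        rw [Matrix.det_fin_three]
        simp [hk]
      rw [hd, hU1, hU2, hL1, hL2, hT0, hT1, hT2, hU0, hL0]
      ring
    rw [hexp]
    exact (((((hprod _ _ _).sub (hprod _ _ _)).sub (hprod _ _ _)).add (hprod _ _ _)).add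
      (hprod _ _ _)).sub (hprod _ _ _)
  have hinj : Function.Injective (algebraMap F[X] (RatFunc F)) := RatFunc.algebraMap_injective F
  have hfin := eq_zero_of_det_companion_orbit_eq_zero
    (x := algebraMap F[X] (RatFunc F) x) (y := algebraMap F[X] (RatFunc F) y)
    (w := algebraMap F[X] (RatFunc F) w) (r := algebraMap F[X] (RatFunc F) r)
    (s := algebraMap F[X] (RatFunc F) s) ((map_ne_zero_iff _ hinj).2 hc) hirr
    (by rw [hr]; simp) (by rw [hs]; simp) (by
      have := congrArg (algebraMap F[X] (RatFunc F)) hzero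
      rw [Matrix.det_fin_three] at this ⊢
      simpa using this)
  simp only [map_eq_zero_iff _ hinj] at hfin
  obtain ⟨rfl, rfl, rfl⟩ := hfin
  simp at hdet

end InvLaurentSeries

/-! ### Conclusion. -/

open InvLaurentSeries in
theorem mainTheorem5 {F : Type*} [Field F] [Finite F] (a b : F[X])
    (ha : 0 < a.natDegree) (hb : 0 < b.natDegree) (hab : a ≠ b) :
    (∃! ξ : InvLaurentSeries F, IsThueMorseContFract a b ξ) ∧
    ∀ ξ : InvLaurentSeries F, IsThueMorseContFract a b ξ →
      Transcendental (RatFunc F) ξ ∨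
        (IsAlgebraic (RatFunc F) ξ ∧ 4 ≤ (minpoly (RatFunc F) ξ).natDegree) := by
  refine ⟨existsUnique_isThueMorseContFract ha hb, fun ξ hξ => ?_⟩
  rw [Transcendental, or_iff_not_imp_left, not_not]
  refine fun halg => ⟨halg, ?_⟩
  by_contra! hlt
  have h : HasContFract ξ (thueMorse a b) := ⟨hξ.1, hξ.2, thueMorse_natDegree_pos ha hb⟩
  have hint : IsIntegral (RatFunc F) ξ := halg.isIntegral
  obtain ⟨d, hd, hp⟩ :=
    IsLocalization.integerNormalization_spec (nonZeroDivisors F[X]) (minpoly (RatFunc F) ξ)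
  set p := IsLocalization.integerNormalization (nonZeroDivisors F[X]) (minpoly (RatFunc F) ξ)
  have hinj : Function.Injective (algebraMap F[X] (RatFunc F)) := RatFunc.algebraMap_injective F
  have hd0 : algebraMap F[X] (RatFunc F) d ≠ 0 :=
    (map_ne_zero_iff _ hinj).2 (nonZeroDivisors.ne_zero hd)
  replace hp : p.map (algebraMap F[X] (RatFunc F))
      = C (algebraMap F[X] (RatFunc F) d) * minpoly (RatFunc F) ξ := by
    rw [hp, ← smul_eq_C_mul, algebraMap_smul]
  have hdeg : p.natDegree = (minpoly (RatFunc F) ξ).natDegree := by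
    rw [← natDegree_map_eq_of_injective hinj, hp, natDegree_C_mul hd0]
  have hp0 : p ≠ 0 := by
    intro h0
    rw [h0, Polynomial.map_zero, eq_comm, mul_eq_zero, C_eq_zero] at hp
    exact hp.elim hd0 (minpoly.ne_zero hint)
  have hcub : p = C (p.coeff 3) * X ^ 3 + C (p.coeff 2) * X ^ 2 + C (p.coeff 1) * X
      + C (p.coeff 0) := by
    conv_lhs => rw [p.as_sum_range_C_mul_X_pow' (n := 4) (by omega)]
    simp [Finset.sum_range_succ]
    ring
  have hroot : p.eval₂ (ofPoly F) ξ = 0 := by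
    have h1 : ofPoly F = (algebraMap (RatFunc F) (InvLaurentSeries F)).comp
        (algebraMap F[X] (RatFunc F)) := RingHom.ext fun q => (algebraMap_algebraMap q).symm
    have h2 := minpoly.aeval (RatFunc F) ξ
    rw [aeval_def] at h2
    rw [h1, ← eval₂_map, hp, eval₂_mul, h2, mul_zero]
  have hroot' : ofPoly F (p.coeff 3) * ξ ^ 3 + ofPoly F (p.coeff 2) * ξ ^ 2
      + ofPoly F (p.coeff 1) * ξ + ofPoly F (p.coeff 0) = 0 := by
    rw [hcub] at hroot
    simpa only [eval₂_add, eval₂_mul, eval₂_C, eval₂_X_pow, eval₂_X] using hroot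
  -- Here `p` is the minimal polynomial with denominators cleared, of degree at most 3. A vanishing
  -- cubic coefficient leaves a nonzero relation of degree at most 2.
  by_cases h3 : p.coeff 3 = 0
  · rw [h3, map_zero, zero_mul, zero_add] at hroot'
    obtain ⟨N, m, hm, hper⟩ := h.eventually_periodic (fun h0 => hp0 (by
      rw [hcub, h3, h0.1, h0.2.1, h0.2.2]; simp)) hroot'
    exact thueMorse_not_periodic hab hm hper
  · refine h.not_cubic (fun N => ⟨4 ^ N, (Nat.lt_pow_self (by norm_num)).le,
      thueMorse_palindrome a b N⟩) h3 ?_ hroot'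
    have hmap : C (algebraMap F[X] (RatFunc F) (p.coeff 3)) * X ^ 3
      + C (algebraMap F[X] (RatFunc F) (p.coeff 2)) * X ^ 2
      + C (algebraMap F[X] (RatFunc F) (p.coeff 1)) * X
      + C (algebraMap F[X] (RatFunc F) (p.coeff 0)) = p.map (algebraMap F[X] (RatFunc F)) := by
      conv_rhs => rw [hcub]
      simp only [Polynomial.map_add, Polynomial.map_mul, Polynomial.map_pow, map_C, map_X]
    rw [hmap, hp]
    exact (irreducible_isUnit_mul (isUnit_C.2 hd0.isUnit)).2 (minpoly.irreducible hint)
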